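/- Let $p$ be a prime, $k$ a field of characteristic $p$, and $G$ a group of order $p^n$. Let $J$ be the Jacobson radical of $kG$, and for $r\ge 1$ let $F_r=\{g\in G : g-1\in J^r\}$. Let $g_1,\dots,g_n$ be Jennings pc-generators of $G$: the sequence splits into consecutive (possibly empty) blocks such that, for each $r\ge1$, the elements of the $r$-th block lie in $F_r$ and are a minimal family of generators of $F_r/F_{r+1}$. Put $a_i=g_i-1$ and let $\dim a_i$ be the $r$ with $a_i\in J^r\setminus J^{r+1}$; extend $\dim$ additively to words in $a_1,\dots,a_n$. Order the letters by $a_1<\dots<a_n$ and order words by the Jennings ordering: $w_1\le_{\mathrm J} w_2$ if $\dim w_1>\dim w_2$; or the dimensions are equal and $\ell(w_1)<\ell(w_2)$, where $\ell$ is length; or dimensions and lengths are equal and $w_1\ge w_2$ lexicographically. Let $I$ be the kernel of the natural homomorphism from the free associative $k$-algebra $k\langle a_1,\dots,a_n\rangle$ to $kG$. A word is a tip if it is the $\le_{\mathrm J}$-largest word in the support of some element of $I$, and a nontip otherwise; a tip is minimal if all its proper (contiguous) subwords are nontips. Then: 1. The minimal tips are exactly the words $a_i^p$ ($1\le i\le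 n$) and $a_ia_j$ with $1\le i<j\le n$. 2. The nontips are exactly the words $a_n^{e_n}a_{n-1}^{e_{n-1}}\cdots a_1^{e_1}$ with $0\le e_i\le p-1$. 3. For every nontip $w$ and every $r\ge 0$, the image of $w$ in $kG$ lies in $J^r\setminus J^{r+1}$ if and only if $\dim w=r$. 4. For each minimal tip $w$ there is a unique linear combination $\nu(w)$ of nontips that equals $w$ in $kG$, and the reduced Gröbner basis $\{w-\nu(w) : w \text{ a minimal tip}\}$ is a finite set with exactly $n(n+1)/2$ elements. 5. The associated monomial algebra, i.e. the quotient of $k\langle a_1,\dots,a_n\rangle$ by the two-sided ideal generated by the tips, depends only on the order of the group: if $H$ is another group of order $p^n$ with Jennings pc-generators $h_1,\dots,h_n$, there is an isomorphism of $k$-algebras between the two associated monomial algebras sending the class of each word to the class of the same word (with $g_i-1$ replaced by $h_i-1$). -/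

import Mathlib

noncomputable section

namespace Jennings

/-- The ideal `J^r` of the group algebra `kG`, where `J` is its Jacobson radical. -/
def radPow (k G : Type*) [Field k] [Group G] (r : ℕ) : Ideal (MonoidAlgebra k G) :=
  Ring.jacobson (MonoidAlgebra k G) ^ r

/-- The element `g - 1` of the group algebra. -/
def subOne (k : Type*) {G : Type*} [Field k] [Group G] (g : G) : MonoidAlgebra k G :=
  MonoidAlgebra.of k G g - 1

/-- The dimension subgroup `F_r(G) = {g ∈ G | g - 1 ∈ J^r(kG)}`. -/
def dimSubgroup (k G : Type*) [Field k] [Group G] (r : ℕ) : Subgroup G where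
  carrier := {g | subOne k g ∈ radPow k G r}
  one_mem' := by simp [subOne, MonoidAlgebra.one_def]
  mul_mem' := by
    intro a b ha hb
    have h : subOne k (a * b) = MonoidAlgebra.of k G a * subOne k b + subOne k a := by
      simp only [subOne, map_mul]; noncomm_ring
    simp only [Set.mem_ofPred_eq] at ha hb ⊢
    rw [h]
    exact Ideal.add_mem _ (Ideal.mul_mem_left _ _ hb) ha
  inv_mem' := by
    intro a ha
    have h : subOne k a⁻¹ = -MonoidAlgebra.of k G a⁻¹ * subOne k a := by
      have : MonoidAlgebra.of k G a⁻¹ * MonoidAlgebra.of k G a = 1 := by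
        rw [← map_mul, inv_mul_cancel, map_one]
      simp only [subOne, mul_sub, neg_mul, this]; noncomm_ring
    simp only [Set.mem_ofPred_eq] at ha ⊢
    rw [h]
    exact Ideal.mul_mem_left _ _ ha

/-- Elements `g_1, …, g_n` of `G` are Jennings pc-generators if they come in consecutive
(possibly empty) blocks, the `r`-th of which (`r ≥ 1`) is a minimal family of generators for
`F_r / F_{r+1}`. Here `s i` is the number of the block containing the `i`-th element, and
elements of `F_r` generate `F_r / F_{r+1}` exactly when together with `F_{r+1}` they
generate `F_r`. -/
def IsJenningsPCGenerators (k : Type*) {G : Type*} [Field k] [Group G] {n : ℕ}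
    (g : Fin n → G) : Prop :=
  ∃ s : Fin n → ℕ, Monotone s ∧ (∀ i, 1 ≤ s i) ∧ ∀ r : ℕ, 1 ≤ r →
    Subgroup.closure (g '' {i | s i = r}) ⊔ dimSubgroup k G (r + 1) = dimSubgroup k G r ∧
    ∀ B : Set (Fin n), B ⊂ {i | s i = r} →
      Subgroup.closure (g '' B) ⊔ dimSubgroup k G (r + 1) ≠ dimSubgroup k G r

/-- The dimension of a nonzero element `a` of `kG`: the `r` with `a ∈ J^r \ J^{r+1}`
(see `dim_eq_of_mem`). -/
def dim {k G : Type*} [Field k] [Group G] (a : MonoidAlgebra k G) : ℕ :=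
  sSup {r | a ∈ radPow k G r}

theorem dim_eq_of_mem {k G : Type*} [Field k] [Group G] {a : MonoidAlgebra k G} {r : ℕ}
    (h : a ∈ radPow k G r) (h' : a ∉ radPow k G (r + 1)) : dim a = r := by
  have hle : ∀ s ∈ {r | a ∈ radPow k G r}, s ≤ r := by
    intro s hs
    by_contra hlt
    exact h' (Ideal.pow_le_pow_right (Nat.succ_le_of_lt (not_le.mp hlt)) hs)
  exact le_antisymm (csSup_le ⟨r, h⟩ hle) (le_csSup ⟨r, hle⟩ h)

/-- The dimension of a word in the Jennings generators `a_i = g_i - 1`: the sum of the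
dimensions of its letters. -/
def wordDim (k : Type*) {G : Type*} [Field k] [Group G] {n : ℕ} (g : Fin n → G)
    (w : FreeMonoid (Fin n)) : ℕ :=
  (w.toList.map fun i => dim (subOne k (g i))).sum

/-- The Jennings ordering `w₁ ≤_J w₂` on words; `List.Lex (· < ·)` is the strict
lexicographic order, with letters ordered by `a_1 < ⋯ < a_n`. -/
def jenningsLE (k : Type*) {G : Type*} [Field k] [Group G] {n : ℕ} (g : Fin n → G)
    (w₁ w₂ : FreeMonoid (Fin n)) : Prop :=
  wordDim k g w₂ < wordDim k g w₁ ∨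
  (wordDim k g w₁ = wordDim k g w₂ ∧ w₁.length < w₂.length) ∨
  (wordDim k g w₁ = wordDim k g w₂ ∧ w₁.length = w₂.length ∧
    (w₁ = w₂ ∨ List.Lex (· < ·) w₂.toList w₁.toList))

/-- The free associative `k`-algebra on `n` letters, with the words as `k`-basis. -/
abbrev FreeAlg (k : Type*) [Field k] (n : ℕ) : Type _ := MonoidAlgebra k (FreeMonoid (Fin n))

/-- A word, as a monomial of the free algebra. -/
def monomial (k : Type*) [Field k] {n : ℕ} (w : FreeMonoid (Fin n)) : FreeAlg k n :=
  MonoidAlgebra.of k (FreeMonoid (Fin n)) w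

/-- The projection of the free algebra to `kG`, sending the `i`-th letter to `a_i = g_i - 1`. -/
def proj (k : Type*) {G : Type*} [Field k] [Group G] {n : ℕ} (g : Fin n → G) :
    FreeAlg k n →ₐ[k] MonoidAlgebra k G :=
  MonoidAlgebra.lift k (MonoidAlgebra k G) (FreeMonoid (Fin n))
    (FreeMonoid.lift fun i => subOne k (g i))

/-- The relations ideal. -/
def relIdeal (k : Type*) {G : Type*} [Field k] [Group G] {n : ℕ} (g : Fin n → G) :
    Ideal (FreeAlg k n) :=
  RingHom.ker (proj k g)

/-- A tip: the largest word in the support of some element of the relations ideal. -/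
def IsTip (k : Type*) {G : Type*} [Field k] [Group G] {n : ℕ} (g : Fin n → G)
    (w : FreeMonoid (Fin n)) : Prop :=
  ∃ f ∈ relIdeal k g, w ∈ f.coeff.support ∧ ∀ v ∈ f.coeff.support, jenningsLE k g v w

/-- A minimal tip: a tip all of whose proper (contiguous) subwords are nontips. -/
def IsMinimalTip (k : Type*) {G : Type*} [Field k] [Group G] {n : ℕ} (g : Fin n → G)
    (w : FreeMonoid (Fin n)) : Prop :=
  IsTip k g w ∧ ∀ u v u' : FreeMonoid (Fin n), w = u * v * u' → v ≠ w → ¬ IsTip k g v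

/-- The space of linear combinations of nontips. -/
def nontipSpan (k : Type*) {G : Type*} [Field k] [Group G] {n : ℕ} (g : Fin n → G) :
    Submodule k (FreeAlg k n) :=
  Submodule.span k (monomial k '' {w | ¬ IsTip k g w})

/-- `v` is a linear combination of nontips that equals the word `w` in `kG`. -/
def IsNormalForm (k : Type*) {G : Type*} [Field k] [Group G] {n : ℕ} (g : Fin n → G)
    (w : FreeMonoid (Fin n)) (v : FreeAlg k n) : Prop :=
  v ∈ nontipSpan k g ∧ proj k g v = proj k g (monomial k w)

/-- The reduced Gröbner basis `{w - ν(w) | w a minimal tip}` of the relations ideal, where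
`ν(w)` is the linear combination of nontips which equals `w` in `kG`. -/
def groebnerBasis (k : Type*) {G : Type*} [Field k] [Group G] {n : ℕ} (g : Fin n → G) :
    Set (FreeAlg k n) :=
  {f | ∃ w v, IsMinimalTip k g w ∧ IsNormalForm k g w v ∧ f = monomial k w - v}

/-- The relations `w = 0`, for `w` a tip. -/
inductive TipRel (k : Type*) {G : Type*} [Field k] [Group G] {n : ℕ} (g : Fin n → G) :
    FreeAlg k n → FreeAlg k n → Prop
  | of (w : FreeMonoid (Fin n)) (hw : IsTip k g w) : TipRel k g (monomial k w) 0

/-- The associated monomial algebra: the quotient of the free algebra by the two-sided ideal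
generated by the tips. -/
abbrev MonomialAlg (k : Type*) {G : Type*} [Field k] [Group G] {n : ℕ} (g : Fin n → G) :
    Type _ :=
  RingQuot (TipRel k g)

/-- The class of a word in the associated monomial algebra. -/
def monomialAlgMk (k : Type*) {G : Type*} [Field k] [Group G] {n : ℕ} (g : Fin n → G)
    (w : FreeMonoid (Fin n)) : MonomialAlg k g :=
  RingQuot.mkAlgHom k (TipRel k g) (monomial k w)

/-- The word `a_n^{e_n} ⋯ a_1^{e_1}`. -/
def pbwWord {n : ℕ} (e : Fin n → ℕ) : FreeMonoid (Fin n) :=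
  ((List.finRange n).reverse.map fun i => FreeMonoid.of i ^ e i).prod

end Jennings

end

/-!
The group algebra of a `p`-group `G` in characteristic `p` is local: every `g - 1` kills a simple
module, since the `p`-group `G` fixes a nonzero vector in the finite additive subgroup generated by
an orbit (`subOne_mem_jacobson`). So the nilpotent radical `J` is spanned by the elements `g - 1`.

For `r ≥ 1` the map `x ↦ x - 1` from `F_r` to `J^r / J^{r+1}` is a homomorphism, so its values are
linear combinations of the `a_i` with `dim a_i = r` (`IsJenningsPCGenerators.subOne_mem_sup`).
Consequently `J^r` is spanned by the words of dimension at least `r`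
(`IsJenningsPCGenerators.radPow_le_wordSpan`). Both `a_i^p = g_i^p - 1` and
`a_i a_j - a_j a_i = (c - 1) g_j g_i`, with `c` a commutator, lie in the power of `J` that their
dimension predicts, and `g_i^p` and `c` in the corresponding dimension subgroup. Hence every word
containing some `a_i^p` or some `a_i a_j` with `i < j` is a combination of words that are smaller
in the Jennings ordering (`IsJenningsPCGenerators.proj_mem_wordSpan_jenningsLT`). As `J` is
nilpotent, this rewriting stops, and every word is a combination of smaller or equal words
`a_n^{e_n} ⋯ a_1^{e_1}` with `e_i < p` (`IsJenningsPCGenerators.proj_mem_wordSpan_isPBW`).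

There are at most `p^n = dim kG` such ordered words and they span `kG`, so they are a basis
(`IsJenningsPCGenerators.linearIndepOn_isPBW`). This count replaces any study of the quotients
`F_r / F_{r+1}`. Everything else is read off from the basis and the rewriting: the nontips are the
ordered words, the minimal tips are the minimal words that are not ordered, the ordered words of
dimension at least `r` span `J^r`, and the set of tips depends on `n` and `p` only, hence so does
the monomial algebra.
-/

namespace Jennings

/-! ### The radical of the group algebra of a `p`-group -/

section Radical

variable {k G : Type*} [Field k] [Group G]

/-- A finite `p`-group acts trivially on every simple module in characteristic `p`, because the
fixed vectors form a nonzero submodule. -/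
theorem subOne_mem_jacobson {p : ℕ} (hp : p.Prime) [CharP k p] [Finite G] (hG : IsPGroup p G)
    (x : G) : subOne k x ∈ Ring.jacobson (MonoidAlgebra k G) := by
  classical
  rw [Ring.jacobson, Module.jacobson, Submodule.mem_sInf]
  intro M hM
  have : Fact p.Prime := ⟨hp⟩
  have hV : IsSimpleModule (MonoidAlgebra k G) (MonoidAlgebra k G ⧸ M) :=
    isSimpleModule_iff_isCoatom.mpr hM
  let V := MonoidAlgebra k G ⧸ M
  let o : V := Submodule.Quotient.mk 1
  have ho : o ≠ 0 := by
    intro h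
    exact hM.1 ((Ideal.eq_top_iff_one M).mpr ((Submodule.Quotient.mk_eq_zero M).mp h))
  have hsingle : ∀ (v : V), (∀ y : G, MonoidAlgebra.of k G y • v = v) → ∀ (y : G) (a : k),
      MonoidAlgebra.single y a • v = MonoidAlgebra.single (1 : G) a • v := by
    intro v hv y a
    conv_rhs => rw [← hv y, smul_smul]
    simp [MonoidAlgebra.of_apply, MonoidAlgebra.single_mul_single]
  -- the submodule of vectors fixed by `G`
  let F : Submodule (MonoidAlgebra k G) V :=
    { carrier := {v | ∀ y : G, MonoidAlgebra.of k G y • v = v}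
      zero_mem' := fun y => smul_zero _
      add_mem' := fun {a b} ha hb y => by rw [smul_add, ha y, hb y]
      smul_mem' := fun c v hv y => by
        induction c using MonoidAlgebra.induction_linear with
        | zero => simp
        | add f g hf hg => rw [add_smul, smul_add, hf, hg]
        | single m r =>
          rw [smul_smul, MonoidAlgebra.of_apply, MonoidAlgebra.single_mul_single, one_mul,
            hsingle v hv, hsingle v hv m] }
  have hpV : ∀ v : V, p • v = 0 := fun v => by
    have h0 : ((p : ℕ) : MonoidAlgebra k G) = 0 := by
      rw [MonoidAlgebra.natCast_def, CharP.cast_eq_zero, MonoidAlgebra.single_zero]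
    rw [← Nat.cast_smul_eq_nsmul (MonoidAlgebra k G), h0, zero_smul]
  -- the finite subgroup of `V` generated by the orbit of `o`, on which `G` acts
  let S : AddSubgroup V := AddSubgroup.closure (Set.range fun y : G => MonoidAlgebra.of k G y • o)
  have hS : ∀ (y : G) (v : V), v ∈ S → MonoidAlgebra.of k G y • v ∈ S := by
    intro y v hv
    induction hv using AddSubgroup.closure_induction with
    | mem v h =>
      obtain ⟨z, rfl⟩ := h
      refine AddSubgroup.subset_closure ⟨y * z, ?_⟩
      simp only [map_mul, mul_smul]
    | zero => simp
    | add a b _ _ ha hb => rw [smul_add]; exact S.add_mem ha hb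
    | neg a _ ha => rw [smul_neg]; exact S.neg_mem ha
  have hfin : Finite S := by
    have : AddGroup.FG S := (AddGroup.fg_iff_addSubgroup_fg S).mpr
      ((AddSubgroup.fg_iff S).mpr ⟨_, rfl, Set.finite_range _⟩)
    refine @AddCommGroup.finite_of_fg_isAddTorsion S _ _ fun s => ?_
    exact isOfFinAddOrder_iff_nsmul_eq_zero.mpr ⟨p, hp.pos, Subtype.ext (hpV s)⟩
  have hoS : o ∈ S := AddSubgroup.subset_closure ⟨1, by simp only [map_one, one_smul]⟩
  let act : MulAction G S :=
    { smul := fun y v => ⟨MonoidAlgebra.of k G y • (v : V), hS y v v.2⟩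
      one_smul := fun v => Subtype.ext (by
        change MonoidAlgebra.of k G 1 • (v : V) = v
        rw [map_one, one_smul])
      mul_smul := fun y z v => Subtype.ext (by
        change MonoidAlgebra.of k G (y * z) • (v : V) = MonoidAlgebra.of k G y •
          MonoidAlgebra.of k G z • (v : V)
        rw [map_mul, mul_smul]) }
  -- `o` has order `p`, so the number of fixed points in `S` is divisible by `p` and not only `0`
  -- is fixed
  have hdvd : p ∣ Nat.card S := by
    have h : addOrderOf (⟨o, hoS⟩ : S) = p :=
      addOrderOf_eq_prime (Subtype.ext (hpV o)) fun h => ho (congrArg Subtype.val h)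
    exact h ▸ addOrderOf_dvd_natCard _
  have h0 : (0 : S) ∈ MulAction.fixedPoints G S := fun y => Subtype.ext (smul_zero _)
  obtain ⟨b, hb, hb0⟩ := hG.exists_fixed_point_of_prime_dvd_card_of_fixed_point S hdvd h0
  have hbF : (b : V) ∈ F := fun y => congrArg Subtype.val (hb y)
  have hF : F = ⊤ := (eq_bot_or_eq_top F).resolve_left fun h => by
    rw [h, Submodule.mem_bot] at hbF
    exact hb0 (Subtype.ext hbF.symm)
  have hoF : o ∈ F := hF ▸ Submodule.mem_top
  have h1 := hoF x
  rw [← sub_eq_zero, ← Submodule.Quotient.mk_smul, ← Submodule.Quotient.mk_sub,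
    Submodule.Quotient.mk_eq_zero, smul_eq_mul, mul_one] at h1
  exact h1

theorem exists_radPow_eq_bot (k G : Type*) [Field k] [Group G] [Finite G] :
    ∃ N, radPow k G N = ⊥ := by
  have : IsArtinianRing (MonoidAlgebra k G) := IsArtinianRing.of_finite k _
  exact IsSemiprimaryRing.isNilpotent (R := MonoidAlgebra k G)

theorem radPow_zero : radPow k G 0 = ⊤ := by
  rw [radPow, Submodule.pow_zero, Ideal.one_eq_top]

theorem radPow_one : radPow k G 1 = Ring.jacobson (MonoidAlgebra k G) := Submodule.pow_one _

theorem radPow_mono {r s : ℕ} (h : r ≤ s) : radPow k G s ≤ radPow k G r :=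
  Ideal.pow_le_pow_right h

instance (r : ℕ) : (radPow k G r).IsTwoSided := by unfold radPow; infer_instance

theorem mul_mem_radPow_add {r s : ℕ} {a b : MonoidAlgebra k G} (ha : a ∈ radPow k G r)
    (hb : b ∈ radPow k G s) : a * b ∈ radPow k G (r + s) := by
  unfold radPow
  rw [Ideal.IsTwoSided.pow_add]
  exact Ideal.mul_mem_mul ha hb

theorem radPow_one_ne_top [Finite G] : radPow k G 1 ≠ ⊤ := by
  rw [radPow_one]
  intro h
  obtain ⟨N, hN⟩ := exists_radPow_eq_bot k G
  rw [radPow, h, Ideal.top_pow] at hN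
  exact top_ne_bot hN

theorem mem_dimSubgroup {r : ℕ} {x : G} : x ∈ dimSubgroup k G r ↔ subOne k x ∈ radPow k G r :=
  Iff.rfl

theorem single_eq_smul_add_smul_subOne (x : G) (c : k) :
    MonoidAlgebra.single x c = c • 1 + c • subOne k x := by
  simp [subOne, smul_sub, MonoidAlgebra.of_apply]

theorem dimSubgroup_one {p : ℕ} (hp : p.Prime) [CharP k p] [Finite G] (hG : IsPGroup p G) :
    dimSubgroup k G 1 = ⊤ :=
  eq_top_iff.mpr fun x _ => by
    rw [mem_dimSubgroup, radPow_one]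
    exact subOne_mem_jacobson hp hG x

theorem mem_span_one_sup_span_subOne (a : MonoidAlgebra k G) :
    a ∈ Submodule.span k {1} ⊔ Submodule.span k (Set.range (subOne k (G := G))) := by
  induction a using MonoidAlgebra.induction_linear with
  | zero => exact zero_mem _
  | add f g hf hg => exact add_mem hf hg
  | single x c =>
    rw [single_eq_smul_add_smul_subOne]
    exact Submodule.add_mem_sup (Submodule.smul_mem _ _ (Submodule.subset_span rfl))
      (Submodule.smul_mem _ _ (Submodule.subset_span ⟨x, rfl⟩))

theorem restrictScalars_radPow_one {p : ℕ} (hp : p.Prime) [CharP k p] [Finite G]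
    (hG : IsPGroup p G) :
    (radPow k G 1).restrictScalars k = Submodule.span k (Set.range (subOne k (G := G))) := by
  have hle : Submodule.span k (Set.range (subOne k (G := G))) ≤
      (radPow k G 1).restrictScalars k := by
    rw [Submodule.span_le]
    rintro _ ⟨x, rfl⟩
    rw [radPow_one]
    exact subOne_mem_jacobson hp hG x
  refine le_antisymm (fun a ha => ?_) hle
  obtain ⟨b, hb, c, hc, rfl⟩ := Submodule.mem_sup.mp (mem_span_one_sup_span_subOne a)
  obtain ⟨t, rfl⟩ := Submodule.mem_span_singleton.mp hb
  have h1 : t • (1 : MonoidAlgebra k G) ∈ (radPow k G 1).restrictScalars k := by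
    simpa using sub_mem ha (hle hc)
  -- a nonzero scalar in `J` would make `J` the whole ring
  have ht : t = 0 := by
    by_contra ht
    refine radPow_one_ne_top (k := k) (G := G) ((Ideal.eq_top_iff_one _).mpr ?_)
    simpa [smul_smul, inv_mul_cancel₀ ht] using Submodule.smul_mem _ t⁻¹ h1
  simpa [ht] using hc

end Radical

/-! ### Ordered words -/

section Words

variable {n p : ℕ}

/-- The words `a_n^{e_n} ⋯ a_1^{e_1}` with `e_i < p`, described intrinsically: the letters are
weakly decreasing and none of them occurs `p` times (see `isPBW_iff_exists_pbwWord`). -/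
def IsPBW (p : ℕ) (w : FreeMonoid (Fin n)) : Prop :=
  w.toList.Pairwise (· ≥ ·) ∧ ∀ i, w.toList.count i < p

/-- The words `a_i^p`, and `a_i a_j` with `i < j`: the minimal words, with respect to taking subwords,
that are not `IsPBW` (see `exists_isObstruction_subword`). -/
def IsObstruction (p : ℕ) (w : FreeMonoid (Fin n)) : Prop :=
  (∃ i, w = FreeMonoid.of i ^ p) ∨ ∃ i j, i < j ∧ w = FreeMonoid.of i * FreeMonoid.of j

theorem toList_of_pow (i : Fin n) (m : ℕ) :
    (FreeMonoid.of i ^ m).toList = List.replicate m i := by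
  induction m with
  | zero => rfl
  | succ m ih => rw [pow_succ', FreeMonoid.toList_mul, ih]; rfl

theorem toList_of_mul_of (i j : Fin n) :
    (FreeMonoid.of i * FreeMonoid.of j).toList = [i, j] := rfl

theorem toList_pbwWord (e : Fin n → ℕ) :
    (pbwWord e).toList = (List.finRange n).reverse.flatMap fun i => List.replicate (e i) i := by
  rw [pbwWord, FreeMonoid.toList_prod, List.flatMap, List.map_map]
  congr 2
  funext i
  exact toList_of_pow i (e i)

theorem count_pbwWord (e : Fin n → ℕ) (j : Fin n) : (pbwWord e).toList.count j = e j := by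
  rw [toList_pbwWord, List.count_flatMap, List.map_reverse, List.sum_reverse, ← List.ofFn_eq_map,
    List.sum_ofFn, Finset.sum_eq_single j]
  · simp
  · intro i _ hij
    simp [List.count_replicate, hij]
  · simp

theorem pairwise_pbwWord (e : Fin n → ℕ) : (pbwWord e).toList.Pairwise (· ≥ ·) := by
  rw [toList_pbwWord, List.pairwise_flatMap]
  refine ⟨fun i _ => List.pairwise_replicate.mpr (Or.inr le_rfl), ?_⟩
  rw [List.pairwise_reverse]
  refine (List.pairwise_lt_finRange n).imp fun {i j} hij x hx y hy => ?_
  rw [List.eq_of_mem_replicate hx, List.eq_of_mem_replicate hy]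
  exact hij.le

theorem eq_pbwWord_count {w : FreeMonoid (Fin n)} (hw : w.toList.Pairwise (· ≥ ·)) :
    w = pbwWord fun i => w.toList.count i := by
  refine FreeMonoid.toList.injective (List.Perm.eq_of_pairwise
    (fun a b _ _ h1 h2 => le_antisymm h2 h1) hw (pairwise_pbwWord _) ?_)
  rw [List.perm_iff_count]
  exact fun i => (count_pbwWord (fun i => w.toList.count i) i).symm

theorem isPBW_iff_exists_pbwWord (hp : 0 < p) (w : FreeMonoid (Fin n)) :
    IsPBW p w ↔ ∃ e : Fin n → ℕ, (∀ i, e i ≤ p - 1) ∧ w = pbwWord e := by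
  constructor
  · rintro ⟨h1, h2⟩
    exact ⟨_, fun i => Nat.le_sub_one_of_lt (h2 i), eq_pbwWord_count h1⟩
  · rintro ⟨e, he, rfl⟩
    refine ⟨pairwise_pbwWord e, fun i => ?_⟩
    rw [count_pbwWord]
    have := he i
    omega

theorem exists_isObstruction_subword {w : FreeMonoid (Fin n)} (hw : ¬ IsPBW p w) :
    ∃ u x u', IsObstruction p x ∧ w = u * x * u' := by
  by_cases h1 : w.toList.Pairwise (· ≥ ·)
  -- a decreasing word collects the occurrences of a letter in one block, which contains `a_i^p`
  · obtain ⟨i, hi⟩ : ∃ i, p ≤ w.toList.count i := by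
      by_contra! h2
      exact hw ⟨h1, h2⟩
    obtain ⟨l₁, l₂, hl⟩ := List.append_of_mem (List.mem_reverse.mpr (List.mem_finRange i))
    refine ⟨(l₁.map fun i => FreeMonoid.of i ^ w.toList.count i).prod, FreeMonoid.of i ^ p,
      FreeMonoid.of i ^ (w.toList.count i - p) *
        (l₂.map fun i => FreeMonoid.of i ^ w.toList.count i).prod, Or.inl ⟨i, rfl⟩, ?_⟩
    conv_lhs => rw [eq_pbwWord_count h1, pbwWord, hl, List.map_append, List.map_cons,
      List.prod_append, List.prod_cons]
    conv_lhs => rw [← Nat.add_sub_cancel' hi, pow_add]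
    simp only [mul_assoc]
  -- a word that is not decreasing has an ascent between adjacent letters
  · rw [← List.isChain_iff_pairwise, List.isChain_iff_forall_rel_of_append_cons_cons] at h1
    push Not at h1
    obtain ⟨i, j, l₁, l₂, hl, hij⟩ := h1
    refine ⟨FreeMonoid.ofList l₁, FreeMonoid.of i * FreeMonoid.of j, FreeMonoid.ofList l₂,
      Or.inr ⟨i, j, hij, rfl⟩, FreeMonoid.toList.injective ?_⟩
    rw [hl]
    simp [FreeMonoid.toList_mul]

theorem IsObstruction.not_isPBW {w : FreeMonoid (Fin n)} (hw : IsObstruction p w) :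
    ¬ IsPBW p w := by
  rintro ⟨h1, h2⟩
  rcases hw with ⟨i, rfl⟩ | ⟨i, j, hij, rfl⟩
  · have := h2 i
    rw [toList_of_pow, List.count_replicate_self] at this
    exact this.false
  · rw [toList_of_mul_of, List.pairwise_pair] at h1
    exact hij.not_ge h1

theorem IsObstruction.isPBW_of_subword (hp : 2 ≤ p) {u v u' : FreeMonoid (Fin n)}
    (hw : IsObstruction p (u * v * u')) (hne : v ≠ u * v * u') : IsPBW p v := by
  have hlist : (u * v * u').toList = u.toList ++ v.toList ++ u'.toList := by
    rw [FreeMonoid.toList_mul, FreeMonoid.toList_mul]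
  have hlen : v.toList.length < (u * v * u').toList.length := by
    by_contra! hlen
    rw [hlist] at hlen
    simp only [List.length_append] at hlen
    apply hne
    apply FreeMonoid.toList.injective
    rw [hlist, List.length_eq_zero_iff.mp (by omega : u.toList.length = 0),
      List.length_eq_zero_iff.mp (by omega : u'.toList.length = 0)]
    simp
  rcases hw with ⟨i, hi⟩ | ⟨i, j, -, hij⟩
  · have hv : v.toList = List.replicate v.toList.length i := by
      refine List.eq_replicate_length.mpr fun b hb => ?_
      have : b ∈ (u * v * u').toList := by
        rw [hlist]; simp [hb]
      rw [hi, toList_of_pow] at this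
      exact List.eq_of_mem_replicate this
    rw [hi, toList_of_pow, List.length_replicate] at hlen
    refine ⟨?_, fun j => List.count_le_length.trans_lt hlen⟩
    rw [hv]
    exact List.pairwise_replicate.mpr (Or.inr le_rfl)
  · rw [hij, toList_of_mul_of] at hlen
    have hlen' : v.toList.length ≤ 1 := Nat.le_of_lt_succ hlen
    refine ⟨?_, fun j => List.count_le_length.trans_lt (by omega)⟩
    match hv : v.toList, hlen' with
    | [], _ => exact List.Pairwise.nil
    | [a], _ => exact List.pairwise_singleton _ _

theorem finite_isObstruction : {w : FreeMonoid (Fin n) | IsObstruction p w}.Finite := by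
  refine ((Set.finite_range fun i : Fin n => FreeMonoid.of i ^ p).union (Set.finite_range
    fun q : Fin n × Fin n => FreeMonoid.of q.1 * FreeMonoid.of q.2)).subset ?_
  rintro w (⟨i, rfl⟩ | ⟨i, j, -, rfl⟩)
  exacts [Or.inl ⟨i, rfl⟩, Or.inr ⟨(i, j), rfl⟩]

/-- The pair `i ≤ j` names the obstruction `a_i a_j`, or `a_i^p` if `i = j`. -/
theorem ncard_isObstruction (hp : 2 ≤ p) :
    {w : FreeMonoid (Fin n) | IsObstruction p w}.ncard = n * (n + 1) / 2 := by
  let f : {q : Fin n × Fin n // q.1 ≤ q.2} → FreeMonoid (Fin n) := fun q =>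
    if q.1.1 = q.1.2 then FreeMonoid.of q.1.1 ^ p else FreeMonoid.of q.1.1 * FreeMonoid.of q.1.2
  have hrange : {w : FreeMonoid (Fin n) | IsObstruction p w} = Set.range f := by
    ext w
    constructor
    · rintro (⟨i, rfl⟩ | ⟨i, j, hij, rfl⟩)
      · exact ⟨⟨(i, i), le_rfl⟩, by simp [f]⟩
      · exact ⟨⟨(i, j), hij.le⟩, by simp [f, hij.ne]⟩
    · rintro ⟨⟨⟨i, j⟩, hij⟩, rfl⟩
      by_cases h : i = j
      · exact Or.inl ⟨i, by simp [f, h]⟩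
      · exact Or.inr ⟨i, j, lt_of_le_of_ne hij h, by simp [f, h]⟩
  have hne : ∀ i j l : Fin n, i ≠ j → FreeMonoid.of l ^ p ≠ FreeMonoid.of i * FreeMonoid.of j := by
    intro i j l hij h
    have h' := congrArg FreeMonoid.toList h
    rw [toList_of_pow, toList_of_mul_of] at h'
    have hi := List.eq_of_mem_replicate (h' ▸ List.mem_cons_self : i ∈ List.replicate p l)
    have hj := List.eq_of_mem_replicate (h' ▸ by simp : j ∈ List.replicate p l)
    exact hij (hi.trans hj.symm)
  have hf : Function.Injective f := by
    rintro ⟨⟨i, j⟩, hij⟩ ⟨⟨i', j'⟩, hij'⟩ h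
    simp only [f] at h
    split_ifs at h with h1 h2 h2
    · have h' := congrArg FreeMonoid.toList h
      rw [toList_of_pow, toList_of_pow] at h'
      have hi := List.eq_of_mem_replicate
        (h' ▸ List.mem_replicate.mpr ⟨by omega, rfl⟩ : i ∈ List.replicate p i')
      simp [← h1, ← h2, hi]
    · exact absurd h (hne _ _ _ h2)
    · exact absurd h.symm (hne _ _ _ h1)
    · have h' := congrArg FreeMonoid.toList h
      rw [toList_of_mul_of, toList_of_mul_of] at h'
      simpa using h'
  rw [hrange, ← Set.image_univ, Set.ncard_image_of_injective _ hf, Set.ncard_univ,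
    Nat.card_congr (Sym2.sortEquiv (α := Fin n)).symm, Nat.card_eq_fintype_card, Sym2.card,
    Fintype.card_fin, Nat.choose_two_right, Nat.add_sub_cancel, mul_comm]

end Words

/-! ### The Jennings ordering -/

section Ordering

variable {k G : Type*} [Field k] [Group G] {n : ℕ} {g : Fin n → G}

/-- The strict Jennings ordering. -/
def JenningsLT (k : Type*) {G : Type*} [Field k] [Group G] {n : ℕ} (g : Fin n → G)
    (v w : FreeMonoid (Fin n)) : Prop :=
  wordDim k g w < wordDim k g v ∨
  (wordDim k g v = wordDim k g w ∧ v.toList.length < w.toList.length) ∨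
  (wordDim k g v = wordDim k g w ∧ v.toList.length = w.toList.length ∧ w.toList < v.toList)

theorem jenningsLE_iff {v w : FreeMonoid (Fin n)} :
    jenningsLE k g v w ↔ v = w ∨ JenningsLT k g v w := by
  constructor
  · rintro (h | ⟨h, h'⟩ | ⟨h, h', rfl | h''⟩)
    · exact Or.inr (Or.inl h)
    · exact Or.inr (Or.inr (Or.inl ⟨h, h'⟩))
    · exact Or.inl rfl
    · exact Or.inr (Or.inr (Or.inr ⟨h, h', h''⟩))
  · rintro (rfl | h | ⟨h, h'⟩ | ⟨h, h', h''⟩)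
    · exact Or.inr (Or.inr ⟨rfl, rfl, Or.inl rfl⟩)
    · exact Or.inl h
    · exact Or.inr (Or.inl ⟨h, h'⟩)
    · exact Or.inr (Or.inr ⟨h, h', Or.inr h''⟩)

theorem JenningsLT.ne {v w : FreeMonoid (Fin n)} (h : JenningsLT k g v w) : v ≠ w := by
  rintro rfl
  rcases h with h | ⟨-, h⟩ | ⟨-, -, h⟩
  · exact h.false
  · exact h.false
  · exact lt_irrefl _ h

theorem JenningsLT.trans {u v w : FreeMonoid (Fin n)} (h : JenningsLT k g u v)
    (h' : JenningsLT k g v w) : JenningsLT k g u w := by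
  rcases h with h | ⟨h1, h2⟩ | ⟨h1, h2, h3⟩ <;> rcases h' with h' | ⟨h1', h2'⟩ | ⟨h1', h2', h3'⟩
  · exact Or.inl (h'.trans h)
  · exact Or.inl (h1' ▸ h)
  · exact Or.inl (h1' ▸ h)
  · exact Or.inl (h1 ▸ h')
  · exact Or.inr (Or.inl ⟨h1.trans h1', h2.trans h2'⟩)
  · exact Or.inr (Or.inl ⟨h1.trans h1', h2' ▸ h2⟩)
  · exact Or.inl (h1 ▸ h')
  · exact Or.inr (Or.inl ⟨h1.trans h1', h2 ▸ h2'⟩)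
  · exact Or.inr (Or.inr ⟨h1.trans h1', h2.trans h2', h3'.trans h3⟩)

theorem JenningsLT.jenningsLE {v w : FreeMonoid (Fin n)} (h : JenningsLT k g v w) :
    jenningsLE k g v w := jenningsLE_iff.mpr (Or.inr h)

theorem JenningsLT.trans_le {u v w : FreeMonoid (Fin n)} (h : Jennings.jenningsLE k g u v)
    (h' : JenningsLT k g v w) : JenningsLT k g u w := by
  rcases jenningsLE_iff.mp h with rfl | h
  exacts [h', h.trans h']

theorem wordDim_mul (u v : FreeMonoid (Fin n)) :
    wordDim k g (u * v) = wordDim k g u + wordDim k g v := by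
  simp [wordDim, FreeMonoid.toList_mul]

theorem wordDim_of (i : Fin n) : wordDim k g (FreeMonoid.of i) = dim (subOne k (g i)) := by
  simp [wordDim]

theorem wordDim_one : wordDim k g 1 = 0 := rfl

theorem JenningsLT.mul_of_wordDim_lt {v w : FreeMonoid (Fin n)} (u u' : FreeMonoid (Fin n))
    (h : wordDim k g w < wordDim k g v) : JenningsLT k g (u * v * u') (u * w * u') := by
  left
  simp only [wordDim_mul]
  omega

theorem JenningsLT.mul_of_length_lt {v w : FreeMonoid (Fin n)} (u u' : FreeMonoid (Fin n))
    (h : wordDim k g v = wordDim k g w) (h' : v.toList.length < w.toList.length) :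
    JenningsLT k g (u * v * u') (u * w * u') := by
  right; left
  simp only [wordDim_mul, FreeMonoid.toList_mul, List.length_append]
  exact ⟨by rw [h], by omega⟩

/-- The Jennings ordering reverses the lexicographic one, so moving the larger letter to the front
makes a word smaller. -/
theorem JenningsLT.mul_swap {i j : Fin n} (u u' : FreeMonoid (Fin n)) (h : i < j) :
    JenningsLT k g (u * (FreeMonoid.of j * FreeMonoid.of i) * u')
      (u * (FreeMonoid.of i * FreeMonoid.of j) * u') := by
  right; right
  refine ⟨?_, by simp [FreeMonoid.toList_mul], ?_⟩
  · simp only [wordDim_mul, add_comm (wordDim k g (FreeMonoid.of j))]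
  · simp only [FreeMonoid.toList_mul, FreeMonoid.toList_of, List.append_assoc]
    exact List.Lex.append_left _ (List.Lex.rel h) _

/-- Only finitely many words have dimension below a given bound when all letters have positive
dimension, so the Jennings ordering is well-founded on them. -/
theorem finite_wordDim_lt (hd : ∀ i, 1 ≤ dim (subOne k (g i))) (N : ℕ) :
    {w : FreeMonoid (Fin n) | wordDim k g w < N}.Finite := by
  refine ((List.finite_length_lt (Fin n) N).preimage FreeMonoid.toList.injective.injOn).subset ?_
  intro w hw
  refine lt_of_le_of_lt ?_ (show wordDim k g w < N from hw)
  simpa [wordDim] using List.card_nsmul_le_sum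
    (w.toList.map fun i => dim (subOne k (g i))) 1 (by simp [hd])

end Ordering

/-! ### Words in the group algebra -/

section WordSpan

variable {k G : Type*} [Field k] [Group G] {n : ℕ} {g : Fin n → G}

/-- The subspace of `kG` spanned by the images of the words in `S`. -/
noncomputable def wordSpan (k : Type*) {G : Type*} [Field k] [Group G] {n : ℕ} (g : Fin n → G)
    (S : Set (FreeMonoid (Fin n))) : Submodule k (MonoidAlgebra k G) :=
  Submodule.span k ((fun w => proj k g (monomial k w)) '' S)

theorem proj_monomial_of (i : Fin n) :
    proj k g (monomial k (FreeMonoid.of i)) = subOne k (g i) := by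
  simp [proj, monomial]

theorem proj_monomial_mul (v w : FreeMonoid (Fin n)) :
    proj k g (monomial k (v * w)) = proj k g (monomial k v) * proj k g (monomial k w) := by
  rw [monomial, map_mul, map_mul, monomial, monomial]

theorem proj_monomial_pow (v : FreeMonoid (Fin n)) (m : ℕ) :
    proj k g (monomial k (v ^ m)) = proj k g (monomial k v) ^ m := by
  rw [monomial, map_pow, map_pow, monomial]

theorem proj_monomial_one : proj k g (monomial k 1) = 1 := by
  rw [monomial, map_one, map_one]

theorem proj_mem_wordSpan {S : Set (FreeMonoid (Fin n))} {w : FreeMonoid (Fin n)} (hw : w ∈ S) :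
    proj k g (monomial k w) ∈ wordSpan k g S :=
  Submodule.subset_span ⟨w, hw, rfl⟩

theorem wordSpan_mono {S T : Set (FreeMonoid (Fin n))} (h : S ⊆ T) :
    wordSpan k g S ≤ wordSpan k g T :=
  Submodule.span_mono (Set.image_mono h)

theorem wordSpan_le {S : Set (FreeMonoid (Fin n))} {V : Submodule k (MonoidAlgebra k G)} :
    wordSpan k g S ≤ V ↔ ∀ w ∈ S, proj k g (monomial k w) ∈ V := by
  rw [wordSpan, Submodule.span_le, Set.image_subset_iff]
  rfl

theorem mul_mul_mem_wordSpan {S T : Set (FreeMonoid (Fin n))} {u u' : FreeMonoid (Fin n)}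
    (h : ∀ v ∈ S, u * v * u' ∈ T) {a : MonoidAlgebra k G} (ha : a ∈ wordSpan k g S) :
    proj k g (monomial k u) * a * proj k g (monomial k u') ∈ wordSpan k g T := by
  induction ha using Submodule.span_induction with
  | mem a ha =>
    obtain ⟨v, hv, rfl⟩ := ha
    simp only [← proj_monomial_mul]
    exact proj_mem_wordSpan (h v hv)
  | zero => simp
  | add a b _ _ ha hb => rw [mul_add, add_mul]; exact add_mem ha hb
  | smul c a _ ha =>
    rw [mul_smul_comm, smul_mul_assoc]; exact Submodule.smul_mem _ _ ha

theorem mul_mem_wordSpan_wordDim {r s : ℕ} {a b : MonoidAlgebra k G}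
    (ha : a ∈ wordSpan k g {w | r ≤ wordDim k g w})
    (hb : b ∈ wordSpan k g {w | s ≤ wordDim k g w}) :
    a * b ∈ wordSpan k g {w | r + s ≤ wordDim k g w} := by
  have h := Submodule.mul_mem_mul ha hb
  rw [wordSpan, wordSpan, Submodule.span_mul_span] at h
  refine Submodule.span_le.mpr ?_ h
  rintro _ ⟨_, ⟨v, hv, rfl⟩, _, ⟨w, hw, rfl⟩, rfl⟩
  simp only [← proj_monomial_mul]
  exact proj_mem_wordSpan (by rw [Set.mem_ofPred_eq, wordDim_mul]; exact add_le_add hv hw)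

/-- The blocks of Jennings pc-generators are the level sets of the dimension: minimality of a block
keeps its elements out of the next dimension subgroup. -/
theorem IsJenningsPCGenerators.dim_spec (hg : IsJenningsPCGenerators k g) :
    (∀ i, 1 ≤ dim (subOne k (g i))) ∧
    (∀ i, subOne k (g i) ∈ radPow k G (dim (subOne k (g i)))) ∧
    ∀ r, 1 ≤ r → dimSubgroup k G r ≤
      Subgroup.closure (g '' {i | dim (subOne k (g i)) = r}) ⊔ dimSubgroup k G (r + 1) := by
  obtain ⟨s, -, hs, hF⟩ := hg
  have hmem : ∀ i, g i ∈ dimSubgroup k G (s i) := fun i => by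
    rw [← (hF (s i) (hs i)).1]
    exact Subgroup.mem_sup_left (Subgroup.subset_closure ⟨i, rfl, rfl⟩)
  have hnotMem : ∀ i, g i ∉ dimSubgroup k G (s i + 1) := by
    intro i hi
    refine (hF (s i) (hs i)).2 ({j | s j = s i} \ {i}) ⟨Set.sdiff_subset, fun h => ?_⟩ ?_
    · exact (h (rfl : s i = s i)).2 rfl
    · rw [← (hF (s i) (hs i)).1]
      refine le_antisymm (sup_le_sup_right (Subgroup.closure_mono
        (Set.image_mono Set.sdiff_subset)) _) (sup_le ?_ le_sup_right)
      rw [Subgroup.closure_le]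
      rintro _ ⟨j, hj, rfl⟩
      by_cases hji : j = i
      · subst hji
        exact Subgroup.mem_sup_right hi
      · exact Subgroup.mem_sup_left (Subgroup.subset_closure ⟨j, ⟨hj, hji⟩, rfl⟩)
  have hdim : ∀ i, dim (subOne k (g i)) = s i := fun i => dim_eq_of_mem (hmem i) (hnotMem i)
  simp only [hdim]
  exact ⟨hs, hmem, fun r hr => (hF r hr).1.ge⟩

/-- The map `x ↦ x - 1` is a homomorphism from `F_r` to `J^r / J^{r+1}`, so its values are spanned
by those at the generators of the `r`-th block. -/
theorem IsJenningsPCGenerators.subOne_mem_sup (hg : IsJenningsPCGenerators k g) {r : ℕ} (hr : 1 ≤ r)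
    {x : G} (hx : x ∈ dimSubgroup k G r) :
    subOne k x ∈ wordSpan k g (FreeMonoid.of '' {i | dim (subOne k (g i)) = r}) ⊔
      (radPow k G (r + 1)).restrictScalars k := by
  let V := wordSpan k g (FreeMonoid.of '' {i | dim (subOne k (g i)) = r}) ⊔
    (radPow k G (r + 1)).restrictScalars k
  have hmul : ∀ a b : MonoidAlgebra k G, a ∈ radPow k G r → b ∈ radPow k G r → a * b ∈ V :=
    fun a b ha hb => Submodule.mem_sup_right
      (radPow_mono (by omega : r + 1 ≤ r + r) (mul_mem_radPow_add ha hb))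
  let K : Subgroup G :=
    { carrier := {x | x ∈ dimSubgroup k G r ∧ subOne k x ∈ V}
      one_mem' := ⟨one_mem _, by rw [subOne, map_one, sub_self]; exact zero_mem _⟩
      mul_mem' := by
        rintro x y ⟨hx, hx'⟩ ⟨hy, hy'⟩
        refine ⟨mul_mem hx hy, ?_⟩
        have h : subOne k (x * y) = subOne k x + subOne k y + subOne k x * subOne k y := by
          simp only [subOne, map_mul]; noncomm_ring
        rw [h]
        exact add_mem (add_mem hx' hy') (hmul _ _ hx hy)
      inv_mem' := by
        rintro x ⟨hx, hx'⟩
        refine ⟨inv_mem hx, ?_⟩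
        have h : subOne k x⁻¹ = -subOne k x - subOne k x⁻¹ * subOne k x := by
          have : MonoidAlgebra.of k G x⁻¹ * MonoidAlgebra.of k G x = 1 := by
            rw [← map_mul, inv_mul_cancel, map_one]
          simp only [subOne, mul_sub, sub_mul, this]; noncomm_ring
        rw [h]
        exact sub_mem (neg_mem hx') (hmul _ _ (inv_mem hx) hx) }
  have hK : Subgroup.closure (g '' {i | dim (subOne k (g i)) = r}) ⊔
      dimSubgroup k G (r + 1) ≤ K := by
    refine sup_le ((Subgroup.closure_le _).mpr ?_) fun y hy =>
      ⟨radPow_mono r.le_succ hy, Submodule.mem_sup_right hy⟩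
    rintro _ ⟨i, hi, rfl⟩
    refine ⟨?_, Submodule.mem_sup_left ?_⟩
    · have := hg.dim_spec.2.1 i
      rwa [hi] at this
    · rw [← proj_monomial_of]
      exact proj_mem_wordSpan ⟨i, hi, rfl⟩
  exact (hK (hg.dim_spec.2.2 r hr hx)).2

theorem IsJenningsPCGenerators.proj_mem_radPow (hg : IsJenningsPCGenerators k g)
    (w : FreeMonoid (Fin n)) : proj k g (monomial k w) ∈ radPow k G (wordDim k g w) := by
  induction w using FreeMonoid.inductionOn' with
  | one => rw [wordDim_one, radPow_zero]; exact Submodule.mem_top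
  | of_mul i w ih =>
    rw [proj_monomial_mul, wordDim_mul, wordDim_of, proj_monomial_of]
    exact mul_mem_radPow_add (hg.dim_spec.2.1 i) ih

variable {p : ℕ}

/-- `J^{r+1} = J^r J`, so it is enough to look at `r = 0` and `r = 1`. -/
theorem IsJenningsPCGenerators.radPow_le_wordSpan_sup (hg : IsJenningsPCGenerators k g)
    (hp : p.Prime) [CharP k p] [Finite G] (hG : IsPGroup p G) (r : ℕ) :
    (radPow k G r).restrictScalars k ≤
      wordSpan k g {w | r ≤ wordDim k g w} ⊔ (radPow k G (r + 1)).restrictScalars k := by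
  have h1 : (radPow k G 1).restrictScalars k ≤
      wordSpan k g {w | 1 ≤ wordDim k g w} ⊔ (radPow k G (1 + 1)).restrictScalars k := by
    rw [restrictScalars_radPow_one hp hG, Submodule.span_le]
    rintro _ ⟨x, rfl⟩
    refine SetLike.le_def.mp (sup_le_sup_right (wordSpan_mono ?_) _)
      (hg.subOne_mem_sup le_rfl (dimSubgroup_one (k := k) hp hG ▸ Subgroup.mem_top x))
    rintro _ ⟨i, hi, rfl⟩
    exact (hi.symm.trans (wordDim_of i).symm).le
  have hle : ∀ r, wordSpan k g {w | r ≤ wordDim k g w} ≤ (radPow k G r).restrictScalars k :=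
    fun r => wordSpan_le.mpr fun w hw => radPow_mono hw (hg.proj_mem_radPow w)
  induction r with
  | zero =>
    intro a _
    obtain ⟨b, hb, c, hc, rfl⟩ := Submodule.mem_sup.mp (mem_span_one_sup_span_subOne a)
    rw [← restrictScalars_radPow_one hp hG] at hc
    refine Submodule.add_mem_sup ?_ hc
    obtain ⟨t, rfl⟩ := Submodule.mem_span_singleton.mp hb
    rw [← proj_monomial_one (g := g)]
    exact Submodule.smul_mem _ _ (proj_mem_wordSpan (Nat.zero_le _))
  | succ r ih =>
    intro a ha
    have ha' : a ∈ radPow k G r * radPow k G 1 := by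
      have : radPow k G (r + 1) = radPow k G r * radPow k G 1 := by
        simp only [radPow, Ideal.IsTwoSided.pow_add]
      rwa [← this]
    refine Submodule.mul_induction_on ha' (fun b hb c hc => ?_) fun b c hb hc => add_mem hb hc
    obtain ⟨b₁, hb₁, b₂, hb₂, rfl⟩ := Submodule.mem_sup.mp (ih hb)
    obtain ⟨c₁, hc₁, c₂, hc₂, rfl⟩ := Submodule.mem_sup.mp (h1 hc)
    rw [add_mul, mul_add, add_assoc (b₁ * c₁)]
    refine Submodule.add_mem_sup (mul_mem_wordSpan_wordDim hb₁ hc₁) (add_mem ?_ ?_)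
    · have : b₁ ∈ radPow k G r := hle r hb₁
      exact mul_mem_radPow_add this (s := 1 + 1) hc₂
    · exact radPow_mono (by omega) (mul_mem_radPow_add hb₂ hc)

/-- Iterating `radPow_le_wordSpan_sup` pushes the error term into `J^N = 0`. -/
theorem IsJenningsPCGenerators.radPow_le_wordSpan (hg : IsJenningsPCGenerators k g)
    (hp : p.Prime) [CharP k p] [Finite G] (hG : IsPGroup p G) (r : ℕ) :
    (radPow k G r).restrictScalars k ≤ wordSpan k g {w | r ≤ wordDim k g w} := by
  obtain ⟨N, hN⟩ := exists_radPow_eq_bot k G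
  have h : ∀ m, (radPow k G r).restrictScalars k ≤
      wordSpan k g {w | r ≤ wordDim k g w} ⊔ (radPow k G (r + m)).restrictScalars k := by
    intro m
    induction m with
    | zero => exact le_sup_right
    | succ m ih =>
      refine ih.trans (sup_le le_sup_left ((hg.radPow_le_wordSpan_sup hp hG (r + m)).trans
        (sup_le_sup_right (wordSpan_mono fun w hw => ?_) _)))
      exact le_trans (Nat.le_add_right r m) hw
  have hbot : radPow k G (r + N) = ⊥ := le_bot_iff.mp (hN ▸ radPow_mono (Nat.le_add_left N r))
  simpa [hbot] using h N

/-! ### Straightening -/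

theorem IsJenningsPCGenerators.subOne_mem_wordSpan (hg : IsJenningsPCGenerators k g)
    (hp : p.Prime) [CharP k p] [Finite G] (hG : IsPGroup p G) {r : ℕ} (hr : 1 ≤ r) {x : G}
    (hx : subOne k x ∈ radPow k G r) :
    subOne k x ∈ wordSpan k g (FreeMonoid.of '' {i | dim (subOne k (g i)) = r} ∪
      {w | r + 1 ≤ wordDim k g w}) :=
  sup_le (wordSpan_mono Set.subset_union_left)
    ((hg.radPow_le_wordSpan hp hG (r + 1)).trans (wordSpan_mono Set.subset_union_right))
    (hg.subOne_mem_sup hr hx)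

/-- Inside a longer word, a subword `x` of length at least two may be replaced by single letters of
the same dimension and by words of higher dimension: the result is smaller. -/
theorem mul_mul_mem_wordSpan_jenningsLT {x u u' : FreeMonoid (Fin n)} {a : MonoidAlgebra k G}
    (hx : 1 < x.toList.length)
    (ha : a ∈ wordSpan k g (FreeMonoid.of '' {i | dim (subOne k (g i)) = wordDim k g x} ∪
      {w | wordDim k g x + 1 ≤ wordDim k g w})) :
    proj k g (monomial k u) * a * proj k g (monomial k u') ∈
      wordSpan k g {v | JenningsLT k g v (u * x * u')} := by
  refine mul_mul_mem_wordSpan ?_ ha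
  rintro _ (⟨i, hi, rfl⟩ | hv)
  · exact JenningsLT.mul_of_length_lt _ _ (wordDim_of (k := k) (g := g) i ▸ hi) hx
  · exact JenningsLT.mul_of_wordDim_lt _ _ hv

/-- A `p`-th power `a_i^p = g_i^p - 1` has dimension at least `p · dim a_i` and is therefore a
combination of single letters of that dimension, modulo words of higher dimension. -/
theorem IsJenningsPCGenerators.mul_pow_mul_mem_wordSpan (hg : IsJenningsPCGenerators k g)
    (hp : p.Prime) [CharP k p] [Finite G] (hG : IsPGroup p G) (i : Fin n)
    (u u' : FreeMonoid (Fin n)) :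
    proj k g (monomial k (u * FreeMonoid.of i ^ p * u')) ∈
      wordSpan k g {v | JenningsLT k g v (u * FreeMonoid.of i ^ p * u')} := by
  have : Fact p.Prime := ⟨hp⟩
  have : CharP (MonoidAlgebra k G) p := charP_of_injective_algebraMap' k p
  have h : proj k g (monomial k (FreeMonoid.of i ^ p)) = subOne k (g i ^ p) := by
    rw [proj_monomial_pow, proj_monomial_of, subOne,
      sub_pow_char_of_commute p (Commute.one_right _), one_pow, subOne, map_pow]
  have hlen : (FreeMonoid.of i ^ p).toList.length = p := by
    rw [toList_of_pow, List.length_replicate]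
  have hdim : wordDim k g (FreeMonoid.of i ^ p) = p * dim (subOne k (g i)) := by
    rw [wordDim, toList_of_pow]; simp
  rw [proj_monomial_mul, proj_monomial_mul]
  refine mul_mul_mem_wordSpan_jenningsLT (hlen.symm ▸ hp.one_lt :) ?_
  rw [h]
  refine hg.subOne_mem_wordSpan hp hG ?_ (h ▸ hg.proj_mem_radPow _)
  rw [hdim]
  exact Nat.mul_pos hp.pos (hg.dim_spec.1 i)

/-- With the commutator `c` of `g_i` and `g_j`, which lies in the dimension subgroup of index
`dim a_i + dim a_j`, one has `a_i a_j = a_j a_i + (c - 1) + (c - 1)(g_j g_i - 1)`. -/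
theorem IsJenningsPCGenerators.mul_swap_mul_mem_wordSpan (hg : IsJenningsPCGenerators k g)
    (hp : p.Prime) [CharP k p] [Finite G] (hG : IsPGroup p G) {i j : Fin n} (hij : i < j)
    (u u' : FreeMonoid (Fin n)) :
    proj k g (monomial k (u * (FreeMonoid.of i * FreeMonoid.of j) * u')) ∈
      wordSpan k g {v | JenningsLT k g v (u * (FreeMonoid.of i * FreeMonoid.of j) * u')} := by
  set d := wordDim k g (FreeMonoid.of i * FreeMonoid.of j) with hd
  have hd' : wordDim k g (FreeMonoid.of j * FreeMonoid.of i) = d := by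
    rw [hd, wordDim_mul, wordDim_mul, add_comm]
  have hd1 : 1 ≤ d := by
    rw [hd, wordDim_mul, wordDim_of]
    have := hg.dim_spec.1 i
    omega
  obtain ⟨c, hcomm⟩ : ∃ c, c * (g j * g i) = g i * g j :=
    ⟨g i * g j * (g j * g i)⁻¹, by group⟩
  have hsub : subOne k c * MonoidAlgebra.of k G (g j * g i) =
      subOne k (g i) * subOne k (g j) - subOne k (g j) * subOne k (g i) := by
    rw [subOne, sub_mul, ← map_mul, hcomm]
    simp only [subOne, map_mul]
    noncomm_ring
  have hc : subOne k c ∈ radPow k G d := by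
    -- `J^d` is two-sided, so the unit `g_j g_i` can be cancelled on the right
    have h : subOne k c = (subOne k (g i) * subOne k (g j) -
        subOne k (g j) * subOne k (g i)) * MonoidAlgebra.of k G (g j * g i)⁻¹ := by
      rw [← hsub, mul_assoc, ← map_mul, mul_inv_cancel, map_one, mul_one]
    rw [h]
    refine Ideal.mul_mem_right _ _ (sub_mem ?_ ?_)
    · rw [← proj_monomial_of, ← proj_monomial_of, ← proj_monomial_mul]
      exact hg.proj_mem_radPow _
    · rw [← proj_monomial_of, ← proj_monomial_of, ← proj_monomial_mul, ← hd']
      exact hg.proj_mem_radPow _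
  have heq : proj k g (monomial k (FreeMonoid.of i * FreeMonoid.of j)) =
      proj k g (monomial k (FreeMonoid.of j * FreeMonoid.of i)) +
        (subOne k c + subOne k c * subOne k (g j * g i)) := by
    have : subOne k c + subOne k c * subOne k (g j * g i) =
        subOne k c * MonoidAlgebra.of k G (g j * g i) := by
      rw [subOne, subOne]; noncomm_ring
    rw [this, hsub, proj_monomial_mul, proj_monomial_mul, proj_monomial_of, proj_monomial_of]
    noncomm_ring
  rw [proj_monomial_mul, proj_monomial_mul, heq, mul_add, add_mul]
  refine add_mem ?_ (mul_mul_mem_wordSpan_jenningsLT (by simp [FreeMonoid.toList_mul])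
    (add_mem (hg.subOne_mem_wordSpan hp hG hd1 hc) ?_))
  · rw [← proj_monomial_mul, ← proj_monomial_mul]
    exact proj_mem_wordSpan (JenningsLT.mul_swap _ _ hij)
  · refine wordSpan_mono Set.subset_union_right (hg.radPow_le_wordSpan hp hG (d + 1) ?_)
    refine mul_mem_radPow_add hc ?_
    rw [radPow_one]
    exact subOne_mem_jacobson hp hG _

/-- A word that is not ordered contains `a_i^p` or `a_i a_j` with `i < j`, and can be rewritten in
terms of smaller words. -/
theorem IsJenningsPCGenerators.proj_mem_wordSpan_jenningsLT (hg : IsJenningsPCGenerators k g)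
    (hp : p.Prime) [CharP k p] [Finite G] (hG : IsPGroup p G) {w : FreeMonoid (Fin n)}
    (hw : ¬ IsPBW p w) :
    proj k g (monomial k w) ∈ wordSpan k g {v | JenningsLT k g v w} := by
  obtain ⟨u, x, u', ⟨i, rfl⟩ | ⟨i, j, hij, rfl⟩, rfl⟩ := exists_isObstruction_subword hw
  · exact hg.mul_pow_mul_mem_wordSpan hp hG i u u'
  · exact hg.mul_swap_mul_mem_wordSpan hp hG hij u u'

/-- The rewriting terminates: words of dimension at least `N` vanish if `J^N = 0`, and the Jennings
ordering is well-founded on the finitely many others. -/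
theorem IsJenningsPCGenerators.proj_mem_wordSpan_isPBW (hg : IsJenningsPCGenerators k g)
    (hp : p.Prime) [CharP k p] [Finite G] (hG : IsPGroup p G) (w : FreeMonoid (Fin n)) :
    proj k g (monomial k w) ∈ wordSpan k g {v | IsPBW p v ∧ jenningsLE k g v w} := by
  obtain ⟨N, hN⟩ := exists_radPow_eq_bot k G
  have hzero : ∀ w, N ≤ wordDim k g w → proj k g (monomial k w) = 0 := fun w hw => by
    have := radPow_mono hw (hg.proj_mem_radPow w)
    rwa [hN] at this
  have : Finite {w : FreeMonoid (Fin n) // wordDim k g w < N} :=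
    (finite_wordDim_lt hg.dim_spec.1 N).to_subtype
  let R : {w : FreeMonoid (Fin n) // wordDim k g w < N} →
    {w : FreeMonoid (Fin n) // wordDim k g w < N} → Prop := fun v w => JenningsLT k g v.1 w.1
  have : IsTrans _ R := ⟨fun _ _ _ h h' => h.trans h'⟩
  have : Std.Irrefl R := ⟨fun _ h => h.ne rfl⟩
  have hwf : WellFounded R := Finite.wellFounded_of_trans_of_irrefl R
  rcases le_or_gt N (wordDim k g w) with hwN | hwN
  · rw [hzero w hwN]
    exact zero_mem _
  · refine hwf.induction (C := fun w => proj k g (monomial k w.1) ∈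
      wordSpan k g {v | IsPBW p v ∧ jenningsLE k g v w.1}) ⟨w, hwN⟩ ?_
    rintro ⟨w, hwN⟩ ih
    by_cases hw : IsPBW p w
    · exact proj_mem_wordSpan ⟨hw, jenningsLE_iff.mpr (Or.inl rfl)⟩
    · refine wordSpan_le.mpr (fun v hv => ?_) (hg.proj_mem_wordSpan_jenningsLT hp hG hw)
      rcases le_or_gt N (wordDim k g v) with hvN | hvN
      · rw [hzero v hvN]
        exact zero_mem _
      · refine wordSpan_mono ?_ (ih ⟨v, hvN⟩ hv)
        exact fun u hu => ⟨hu.1, (JenningsLT.trans_le hu.2 hv).jenningsLE⟩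

end WordSpan

/-! ### The basis of ordered words -/

section Basis

variable {k G : Type*} [Field k] [Group G] {n p : ℕ} {g : Fin n → G}

/-- The ordered words span `kG`, and there are at most `p ^ n`, the dimension of `kG`, of them. -/
theorem IsJenningsPCGenerators.linearIndepOn_isPBW (hg : IsJenningsPCGenerators k g)
    (hp : p.Prime) [CharP k p] (hG : Nat.card G = p ^ n) :
    LinearIndepOn k (fun w => proj k g (monomial k w)) {w : FreeMonoid (Fin n) | IsPBW p w} := by
  have hfin : Finite G := Nat.finite_of_card_ne_zero (hG ▸ pow_ne_zero _ hp.ne_zero)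
  have : Fintype G := Fintype.ofFinite G
  let b : (Fin n → Fin p) → {w : FreeMonoid (Fin n) | IsPBW p w} := fun e =>
    ⟨pbwWord fun i => e i, (isPBW_iff_exists_pbwWord hp.pos _).mpr
      ⟨_, fun i => Nat.le_sub_one_of_lt (e i).2, rfl⟩⟩
  have hb : Function.Surjective b := by
    rintro ⟨w, hw⟩
    exact ⟨fun i => ⟨_, hw.2 i⟩, Subtype.ext (eq_pbwWord_count hw.1).symm⟩
  have := Finite.of_surjective b hb
  have : Fintype {w : FreeMonoid (Fin n) | IsPBW p w} := Fintype.ofFinite _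
  refine linearIndependent_of_top_le_span_of_card_le_finrank ?_ ?_
  · intro a _
    have ha := hg.radPow_le_wordSpan hp (IsPGroup.of_card hG) 0 (radPow_zero (k := k) (G := G) ▸
      Submodule.mem_top : a ∈ radPow k G 0)
    have h : wordSpan k g {w | 0 ≤ wordDim k g w} ≤ wordSpan k g {w | IsPBW p w} :=
      wordSpan_le.mpr fun w _ => wordSpan_mono (fun v hv => hv.1)
        (hg.proj_mem_wordSpan_isPBW hp (IsPGroup.of_card hG) w)
    simpa [wordSpan, Set.image_eq_range] using h ha
  · have hcard := Fintype.card_le_of_surjective b hb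
    have hrank : Module.finrank k (MonoidAlgebra k G) = p ^ n := by
      rw [LinearEquiv.finrank_eq (MonoidAlgebra.coeffLinearEquiv k (S := k) (M := G)),
        Module.finrank_finsupp_self, ← hG, Nat.card_eq_fintype_card]
    rw [hrank]
    simpa using hcard

theorem notMem_wordSpan_of_linearIndepOn {S T : Set (FreeMonoid (Fin n))}
    (hT : LinearIndepOn k (fun w => proj k g (monomial k w)) T) (hST : S ⊆ T)
    {w : FreeMonoid (Fin n)} (hw : w ∈ T) (hwS : w ∉ S) :
    proj k g (monomial k w) ∉ wordSpan k g S := by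
  have h := LinearIndependent.notMem_span_image hT (s := {v | v.1 ∈ S}) (x := ⟨w, hw⟩) hwS
  refine fun h' => h (Submodule.span_mono ?_ h')
  rintro _ ⟨v, hv, rfl⟩
  exact ⟨⟨v, hST hv⟩, hv, rfl⟩

theorem IsJenningsPCGenerators.radPow_le_wordSpan_isPBW (hg : IsJenningsPCGenerators k g)
    (hp : p.Prime) [CharP k p] [Finite G] (hG : IsPGroup p G) (r : ℕ) :
    (radPow k G r).restrictScalars k ≤ wordSpan k g {w | IsPBW p w ∧ r ≤ wordDim k g w} := by
  refine (hg.radPow_le_wordSpan hp hG r).trans (wordSpan_le.mpr fun w hw => ?_)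
  refine SetLike.le_def.mp (wordSpan_mono ?_) (hg.proj_mem_wordSpan_isPBW hp hG w)
  refine fun v hv => ⟨hv.1, ?_⟩
  have hw' : r ≤ wordDim k g w := hw
  rcases hv.2 with h | ⟨h, -⟩ | ⟨h, -⟩ <;> omega

/-- `J^{d+1}` is spanned by other ordered words, so it misses an ordered word of dimension `d`. -/
theorem IsJenningsPCGenerators.proj_notMem_radPow (hg : IsJenningsPCGenerators k g)
    (hp : p.Prime) [CharP k p] (hG : Nat.card G = p ^ n) {w : FreeMonoid (Fin n)}
    (hw : IsPBW p w) : proj k g (monomial k w) ∉ radPow k G (wordDim k g w + 1) := by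
  have hfin : Finite G := Nat.finite_of_card_ne_zero (hG ▸ pow_ne_zero _ hp.ne_zero)
  intro h
  refine notMem_wordSpan_of_linearIndepOn (hg.linearIndepOn_isPBW hp hG) (fun v hv => hv.1) hw
    (fun h' => ?_) (hg.radPow_le_wordSpan_isPBW hp (IsPGroup.of_card hG) (wordDim k g w + 1) h)
  exact Nat.not_succ_le_self _ h'.2

end Basis

/-! ### Tips and normal forms -/

section Tips

variable {k G : Type*} [Field k] [Group G] {n p : ℕ} {g : Fin n → G}

theorem proj_eq_linearCombination (f : FreeAlg k n) :
    proj k g f = Finsupp.linearCombination k (fun w => proj k g (monomial k w)) f.coeff := by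
  induction f using MonoidAlgebra.induction_linear with
  | zero => simp
  | add a b ha hb => rw [map_add, ha, hb, MonoidAlgebra.coeff_add, map_add]
  | single w c =>
    rw [MonoidAlgebra.coeff_single, Finsupp.linearCombination_single, ← map_smul, monomial,
      MonoidAlgebra.of_apply, MonoidAlgebra.smul_single', mul_one]

theorem coeff_monomial (w : FreeMonoid (Fin n)) :
    (monomial k w).coeff = Finsupp.single w 1 := rfl

theorem coeff_mem_supported {S : Set (FreeMonoid (Fin n))} {f : FreeAlg k n}
    (hf : f ∈ Submodule.span k (monomial k '' S)) : f.coeff ∈ Finsupp.supported k k S := by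
  induction hf using Submodule.span_induction with
  | mem a ha =>
    obtain ⟨w, hw, rfl⟩ := ha
    exact Finsupp.single_mem_supported k 1 hw
  | zero => exact zero_mem _
  | add a b _ _ ha hb => exact add_mem ha hb
  | smul c a _ ha => exact Submodule.smul_mem _ c ha

theorem exists_mem_span_of_mem_wordSpan {S : Set (FreeMonoid (Fin n))} {a : MonoidAlgebra k G}
    (ha : a ∈ wordSpan k g S) : ∃ f ∈ Submodule.span k (monomial k '' S), proj k g f = a := by
  have h : wordSpan k g S =
      (Submodule.span k (monomial k '' S)).map (proj k g).toLinearMap := by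
    rw [Submodule.map_span, ← Set.image_comp]
    rfl
  rw [h] at ha
  exact ha

/-- A word that is not ordered differs from a combination of smaller words by a relation. -/
theorem IsJenningsPCGenerators.isTip_of_not_isPBW (hg : IsJenningsPCGenerators k g)
    (hp : p.Prime) [CharP k p] [Finite G] (hG : IsPGroup p G) {w : FreeMonoid (Fin n)}
    (hw : ¬ IsPBW p w) : IsTip k g w := by
  obtain ⟨f, hf, hfw⟩ := exists_mem_span_of_mem_wordSpan (hg.proj_mem_wordSpan_isPBW hp hG w)
  have hsupp := (Finsupp.mem_supported k _).mp (coeff_mem_supported hf)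
  have hwf : f.coeff w = 0 := by
    by_contra h
    exact hw (hsupp (Finsupp.mem_support_iff.mpr h)).1
  refine ⟨monomial k w - f, ?_, ?_, fun v hv => ?_⟩
  · rw [relIdeal, RingHom.mem_ker, map_sub, hfw, sub_self]
  · rw [Finsupp.mem_support_iff, MonoidAlgebra.coeff_sub, Finsupp.sub_apply, hwf, coeff_monomial]
    simp
  · by_cases hvw : v = w
    · exact jenningsLE_iff.mpr (Or.inl hvw)
    · refine (hsupp (Finset.mem_coe.mpr ?_) : IsPBW p v ∧ jenningsLE k g v w).2
      rw [Finsupp.mem_support_iff, MonoidAlgebra.coeff_sub, Finsupp.sub_apply, coeff_monomial,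
        Finsupp.single_eq_of_ne hvw] at hv
      rw [Finsupp.mem_support_iff]
      simpa using hv

/-- If `w` were the tip of `f`, rewriting the other words of `f` in terms of ordered words would
express the image of `w` by ordered words different from `w`. -/
theorem IsJenningsPCGenerators.not_isTip_of_isPBW (hg : IsJenningsPCGenerators k g)
    (hp : p.Prime) [CharP k p] (hG : Nat.card G = p ^ n) {w : FreeMonoid (Fin n)}
    (hw : IsPBW p w) : ¬ IsTip k g w := by
  have hfin : Finite G := Nat.finite_of_card_ne_zero (hG ▸ pow_ne_zero _ hp.ne_zero)
  classical
  rintro ⟨f, hf, hfw, hmax⟩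
  refine notMem_wordSpan_of_linearIndepOn (hg.linearIndepOn_isPBW hp hG)
    (S := {v | IsPBW p v ∧ v ≠ w}) (fun v hv => hv.1) hw (fun h => h.2 rfl) ?_
  rw [relIdeal, RingHom.mem_ker, proj_eq_linearCombination, ← Finsupp.single_add_erase w f.coeff,
    map_add, Finsupp.linearCombination_single] at hf
  refine (Submodule.smul_mem_iff _ (Finsupp.mem_support_iff.mp hfw)).mp ?_
  rw [eq_neg_of_add_eq_zero_left hf, Finsupp.linearCombination_apply]
  refine neg_mem (Submodule.sum_mem _ fun v hv => Submodule.smul_mem _ _ ?_)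
  rw [Finsupp.support_erase, Finset.mem_erase] at hv
  have hlt : JenningsLT k g v w := (jenningsLE_iff.mp (hmax v hv.2)).resolve_left hv.1
  refine SetLike.le_def.mp (wordSpan_mono ?_)
    (hg.proj_mem_wordSpan_isPBW hp (IsPGroup.of_card hG) v)
  exact fun u hu => ⟨hu.1, (JenningsLT.trans_le hu.2 hlt).ne⟩

theorem IsJenningsPCGenerators.isTip_iff (hg : IsJenningsPCGenerators k g)
    (hp : p.Prime) [CharP k p] (hG : Nat.card G = p ^ n) (w : FreeMonoid (Fin n)) :
    IsTip k g w ↔ ¬ IsPBW p w := by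
  have hfin : Finite G := Nat.finite_of_card_ne_zero (hG ▸ pow_ne_zero _ hp.ne_zero)
  exact ⟨fun h hw => hg.not_isTip_of_isPBW hp hG hw h,
    hg.isTip_of_not_isPBW hp (IsPGroup.of_card hG)⟩

theorem IsJenningsPCGenerators.isMinimalTip_iff (hg : IsJenningsPCGenerators k g)
    (hp : p.Prime) [CharP k p] (hG : Nat.card G = p ^ n) (w : FreeMonoid (Fin n)) :
    IsMinimalTip k g w ↔ IsObstruction p w := by
  simp only [IsMinimalTip, hg.isTip_iff hp hG, not_not]
  constructor
  · rintro ⟨hw, hmin⟩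
    obtain ⟨u, x, u', hx, h⟩ := exists_isObstruction_subword hw
    by_cases hxw : x = w
    · exact hxw ▸ hx
    · exact absurd (hmin u x u' h hxw) hx.not_isPBW
  · intro hw
    refine ⟨hw.not_isPBW, ?_⟩
    rintro u v u' rfl hv
    exact hw.isPBW_of_subword hp.two_le hv

theorem IsJenningsPCGenerators.existsUnique_isNormalForm (hg : IsJenningsPCGenerators k g)
    (hp : p.Prime) [CharP k p] (hG : Nat.card G = p ^ n) (w : FreeMonoid (Fin n)) :
    ∃! v, IsNormalForm k g w v := by
  have hfin : Finite G := Nat.finite_of_card_ne_zero (hG ▸ pow_ne_zero _ hp.ne_zero)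
  have hspan : nontipSpan k g = Submodule.span k (monomial k '' {v | IsPBW p v}) := by
    simp only [nontipSpan, hg.isTip_iff hp hG, not_not]
  obtain ⟨f, hf, hfw⟩ := exists_mem_span_of_mem_wordSpan
    (wordSpan_mono (fun v hv => hv.1) (hg.proj_mem_wordSpan_isPBW hp (IsPGroup.of_card hG) w) :
      proj k g (monomial k w) ∈ wordSpan k g {v | IsPBW p v})
  refine ⟨f, ⟨hspan ▸ hf, hfw⟩, fun f' hf' => ?_⟩
  have hsub := coeff_mem_supported (sub_mem (hspan ▸ hf'.1) hf)
  have hzero : proj k g (f' - f) = 0 := by rw [map_sub, hf'.2, hfw, sub_self]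
  rw [proj_eq_linearCombination] at hzero
  have := linearIndepOn_iff.mp (hg.linearIndepOn_isPBW hp hG) _ hsub hzero
  exact sub_eq_zero.mp (MonoidAlgebra.coeff_eq_zero.mp this)

/-- A minimal tip can be read off from its element `w - ν(w)` of the Gröbner basis, as the only
tip in the support. -/
theorem IsJenningsPCGenerators.groebnerBasis_eq_image (hg : IsJenningsPCGenerators k g)
    (hp : p.Prime) [CharP k p] (hG : Nat.card G = p ^ n) :
    ∃ F : FreeMonoid (Fin n) → FreeAlg k n, Set.InjOn F {w | IsObstruction p w} ∧
      groebnerBasis k g = F '' {w | IsObstruction p w} := by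
  choose ν hν hν' using hg.existsUnique_isNormalForm hp hG
  refine ⟨fun w => monomial k w - ν w, ?_, ?_⟩
  · intro v hv w hw h
    have hcoeff : ∀ u, (ν u).coeff v = 0 := by
      intro u
      by_contra hne
      exact (Finsupp.mem_supported k _).mp (coeff_mem_supported (hν u).1)
        (Finsupp.mem_support_iff.mpr hne)
        ((hg.isTip_iff hp hG v).mpr (IsObstruction.not_isPBW hv))
    have h' := congrArg (fun f => f.coeff v) h
    simp only [MonoidAlgebra.coeff_sub, Finsupp.sub_apply, hcoeff, coeff_monomial,
      Finsupp.single_eq_same, sub_zero] at h'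
    by_contra hvw
    rw [Finsupp.single_eq_of_ne hvw] at h'
    exact one_ne_zero h'
  · ext f
    constructor
    · rintro ⟨w, v, hw, hv, rfl⟩
      exact ⟨w, (hg.isMinimalTip_iff hp hG w).mp hw, by simp only [hν' w v hv]⟩
    · rintro ⟨w, hw, rfl⟩
      exact ⟨w, ν w, (hg.isMinimalTip_iff hp hG w).mpr hw, hν w, rfl⟩

theorem exists_ringQuot_algEquiv_of_eq {R A : Type*} [CommSemiring R] [Semiring A] [Algebra R A]
    {r s : A → A → Prop} (h : r = s) :
    ∃ φ : RingQuot r ≃ₐ[R] RingQuot s,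
      ∀ a, φ (RingQuot.mkAlgHom R r a) = RingQuot.mkAlgHom R s a := by
  subst h
  exact ⟨AlgEquiv.refl, fun _ => rfl⟩

theorem tipRel_eq_of_isTip_iff {H : Type*} [Group H] {h : Fin n → H}
    (hgh : ∀ w, IsTip k g w ↔ IsTip k h w) : TipRel k g = TipRel k h := by
  ext a b
  constructor
  · rintro ⟨w, hw⟩
    exact ⟨w, (hgh w).mp hw⟩
  · rintro ⟨w, hw⟩
    exact ⟨w, (hgh w).mpr hw⟩

end Tips

end Jennings

theorem mainTheorem1 {p : ℕ} (hp : p.Prime) {k : Type*} [Field k] [CharP k p]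
    {G : Type*} [Group G] {n : ℕ} (hG : Nat.card G = p ^ n)
    (g : Fin n → G) (hg : Jennings.IsJenningsPCGenerators k g) :
    (∀ w : FreeMonoid (Fin n), Jennings.IsMinimalTip k g w ↔
      (∃ i, w = FreeMonoid.of i ^ p) ∨
      (∃ i j, i < j ∧ w = FreeMonoid.of i * FreeMonoid.of j)) ∧
    (∀ w : FreeMonoid (Fin n), ¬ Jennings.IsTip k g w ↔
      ∃ e : Fin n → ℕ, (∀ i, e i ≤ p - 1) ∧ w = Jennings.pbwWord e) ∧
    (∀ w : FreeMonoid (Fin n), ¬ Jennings.IsTip k g w → ∀ r : ℕ,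
      (Jennings.proj k g (Jennings.monomial k w) ∈ Jennings.radPow k G r ∧
        Jennings.proj k g (Jennings.monomial k w) ∉ Jennings.radPow k G (r + 1)) ↔
      Jennings.wordDim k g w = r) ∧
    (∀ w : FreeMonoid (Fin n), Jennings.IsMinimalTip k g w →
      ∃! v, Jennings.IsNormalForm k g w v) ∧
    (Jennings.groebnerBasis k g).Finite ∧
    (Jennings.groebnerBasis k g).ncard = n * (n + 1) / 2 ∧
    (∀ (H : Type*) [Group H] (h : Fin n → H), Nat.card H = p ^ n →
      Jennings.IsJenningsPCGenerators k h →
      ∃ φ : Jennings.MonomialAlg k g ≃ₐ[k] Jennings.MonomialAlg k h,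
        ∀ w : FreeMonoid (Fin n),
          φ (Jennings.monomialAlgMk k g w) = Jennings.monomialAlgMk k h w) := by
  obtain ⟨F, hF, hgb⟩ := hg.groebnerBasis_eq_image hp hG
  refine ⟨hg.isMinimalTip_iff hp hG, fun w => ?_, fun w hw r => ?_,
    fun w _ => hg.existsUnique_isNormalForm hp hG w, ?_, ?_, fun H _ h hH hh => ?_⟩
  · rw [hg.isTip_iff hp hG, not_not, Jennings.isPBW_iff_exists_pbwWord hp.pos]
  · rw [hg.isTip_iff hp hG, not_not] at hw
    have hmem := hg.proj_mem_radPow w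
    have hnotMem := hg.proj_notMem_radPow hp hG hw
    constructor
    · rintro ⟨h, h'⟩
      exact (Jennings.dim_eq_of_mem hmem hnotMem).symm.trans (Jennings.dim_eq_of_mem h h')
    · rintro rfl
      exact ⟨hmem, hnotMem⟩
  · rw [hgb]
    exact Jennings.finite_isObstruction.image F
  · rw [hgb, hF.ncard_image, Jennings.ncard_isObstruction hp.two_le]
  · obtain ⟨φ, hφ⟩ := Jennings.exists_ringQuot_algEquiv_of_eq (R := k)
      (Jennings.tipRel_eq_of_isTip_iff (k := k) (g := g) (h := h) fun w => by
        rw [hg.isTip_iff hp hG, hh.isTip_iff hp hH])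
    exact ⟨φ, fun w => hφ _⟩
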